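/- **Theorem 2.** Each recursively enumerable proof system for the first-order language on natural numbers with $0$, $1$, $+$, $\cdot$, and $=$ either proves a false sentence or fails to prove a true sentence. Here the language is the following. Its strings are finite sequences over a fixed alphabet of 53 characters: the letters $a,\dots,z$, the digits $0,\dots,9$, and the characters `"`, `\`, `=`, $\neq$, `(`, `)`, `~`, `&`, `|`, `-`, `>`, `A`, `E`, `:`, `+`, `*`, `<`. A variable is a lower case letter followed by zero or more digits. A number literal is `0` or a non-empty sequence of digits that does not start with `0`. Terms are built from variables and number literals with `+`, `*` and parentheses; `*` has higher precedence than `+`. Atomic propositions are $t=u$ and $t\neq u$ for terms $t,u$. Formulas are built from atomic propositions with parentheses, `~` (not), `&` (and), `|` (or), `->` (implies), `A`$x$`:` (for every natural number $x$) and `E`$x$`:` (there is a natural number $x$); the precedences of `~`, `&`, `|`, `->`, `:` decrease in this order, so that the scope of a quantifier extends as far to the right as possible, and binary operators associate to the left. A sentence is a formula without free variables; it is true or false according to its meaning in the natural numbers. A Turing machine has a tape that is infinite in both directions, the 53 characters and a blank as tape symbols, and states $0,\dots,r$ for some $r\ge 1$. For each state other than $0$ and each tape symbol it has exactly one rule,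 which gives the symbol to be written, the next state, and whether the head moves one cell to the left, one cell to the right, or not at all. It starts in state $1$ with its head on the first character of the input on an otherwise blank tape, and it halts when it enters state $0$. A recursively enumerable proof system is a Turing machine that does not halt on any string that is not a sentence; it proves a sentence if and only if it halts on that sentence. -/

import Mathlib

namespace NatArith

/-! ### Characters and strings -/

/-- The 53 characters: 26 lower case letters, 10 digits and 17 other characters. -/
inductive Sym : Type
  | letter (i : Fin 26)
  | digit (d : Fin 10)
  | quote | backslash | eq | ne | lpar | rpar | tilde | amp | bar | dash | gt
  | capA | capE | colon | plus | star | lt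
  deriving DecidableEq

/-- A string is a finite sequence of characters. -/
abbrev Str : Type := List Sym

/-! ### Abstract formulas of arithmetic and their meaning in the natural numbers -/

/-- A variable: a lower case letter followed by zero or more digits. -/
structure Var : Type where
  letter : Fin 26
  digits : List (Fin 10)
  deriving DecidableEq

/-- The string that a variable is. -/
def Var.str (x : Var) : Str := Sym.letter x.letter :: x.digits.map Sym.digit

/-- Terms, up to the way they are written. -/
inductive Tm : Type
  | var (x : Var)
  | num (n : ℕ)
  | add (t u : Tm)
  | mul (t u : Tm)

/-- The value of a term when the variables contain the numbers given by `v`. -/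
def Tm.val (v : Var → ℕ) : Tm → ℕ
  | .var x => v x
  | .num n => n
  | .add t u => t.val v + u.val v
  | .mul t u => t.val v * u.val v

/-- The variables that occur in a term. -/
def Tm.vars : Tm → Set Var
  | .var x => {x}
  | .num _ => ∅
  | .add t u => t.vars ∪ u.vars
  | .mul t u => t.vars ∪ u.vars

/-- First-order formulas, up to the way they are written. -/
inductive Fml : Type
  | eq (t u : Tm)
  | ne (t u : Tm)
  | not (p : Fml)
  | and (p q : Fml)
  | or (p q : Fml)
  | imp (p q : Fml)
  | all (x : Var) (p : Fml)
  | ex (x : Var) (p : Fml)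

/-- The formula holds in the natural numbers, when the variables contain the numbers given by `v`. -/
def Fml.Holds : Fml → (Var → ℕ) → Prop
  | .eq t u, v => t.val v = u.val v
  | .ne t u, v => t.val v ≠ u.val v
  | .not p, v => ¬ p.Holds v
  | .and p q, v => p.Holds v ∧ q.Holds v
  | .or p q, v => p.Holds v ∨ q.Holds v
  | .imp p q, v => p.Holds v → q.Holds v
  | .all x p, v => ∀ n : ℕ, p.Holds (Function.update v x n)
  | .ex x p, v => ∃ n : ℕ, p.Holds (Function.update v x n)

/-- The free variables of a formula. -/
def Fml.free : Fml → Set Var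
  | .eq t u => t.vars ∪ u.vars
  | .ne t u => t.vars ∪ u.vars
  | .not p => p.free
  | .and p q => p.free ∪ q.free
  | .or p q => p.free ∪ q.free
  | .imp p q => p.free ∪ q.free
  | .all x p => p.free \ {x}
  | .ex x p => p.free \ {x}

/-! ### How terms and formulas are written as strings -/

/-- A number literal: the digit 0 alone, or a non-empty sequence of digits that does not start
with 0. -/
def IsLiteral (ds : List (Fin 10)) : Prop :=
  ds = [0] ∨ (ds ≠ [] ∧ ds.head? ≠ some 0)

/-- The number that a sequence of decimal digits denotes. -/
def decimalValue (ds : List (Fin 10)) : ℕ := ds.foldl (fun n d => 10 * n + (d : ℕ)) 0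

/-- `ReadsTm k s t`: the string `s` is a term that is read as `t`.
The level `k` tells which operators may be outermost in `s`:
0: everything; 1: everything except `+`; 2: only variables, literals and parentheses.
Operators associate to the left. -/
inductive ReadsTm : ℕ → Str → Tm → Prop
  | var (x : Var) : ReadsTm 2 x.str (.var x)
  | lit (ds : List (Fin 10)) (h : IsLiteral ds) :
      ReadsTm 2 (ds.map Sym.digit) (.num (decimalValue ds))
  | paren {s : Str} {t : Tm} (h : ReadsTm 0 s t) :
      ReadsTm 2 ([Sym.lpar] ++ s ++ [Sym.rpar]) t
  | mul {s₁ s₂ : Str} {t u : Tm} (h₁ : ReadsTm 1 s₁ t) (h₂ : ReadsTm 2 s₂ u) :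
      ReadsTm 1 (s₁ ++ [Sym.star] ++ s₂) (.mul t u)
  | add {s₁ s₂ : Str} {t u : Tm} (h₁ : ReadsTm 0 s₁ t) (h₂ : ReadsTm 1 s₂ u) :
      ReadsTm 0 (s₁ ++ [Sym.plus] ++ s₂) (.add t u)
  | weaken {k : ℕ} {s : Str} {t : Tm} (h : ReadsTm (k + 1) s t) : ReadsTm k s t

/-- `ReadsFml k b s p`: the string `s` is a formula that is read as `p`.
The level `k` tells which binary and unary connectives may be outermost in `s`:
0: all; 1: all except `->`; 2: also not `|`; 3: also not `&`; 4: also not `~`.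
Binary connectives associate to the left. The colon of a quantifier has the lowest precedence:
the scope of a quantifier extends to the right as far as possible. The flag `b` is `true` when
some quantifier outside parentheses has its scope extend to the end of `s`; then `s` cannot be the
left operand of a connective. -/
inductive ReadsFml : ℕ → Bool → Str → Fml → Prop
  | eq {s₁ s₂ : Str} {t u : Tm} (h₁ : ReadsTm 0 s₁ t) (h₂ : ReadsTm 0 s₂ u) :
      ReadsFml 4 false (s₁ ++ [Sym.eq] ++ s₂) (.eq t u)
  | ne {s₁ s₂ : Str} {t u : Tm} (h₁ : ReadsTm 0 s₁ t) (h₂ : ReadsTm 0 s₂ u) :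
      ReadsFml 4 false (s₁ ++ [Sym.ne] ++ s₂) (.ne t u)
  | paren {b : Bool} {s : Str} {p : Fml} (h : ReadsFml 0 b s p) :
      ReadsFml 4 false ([Sym.lpar] ++ s ++ [Sym.rpar]) p
  | not {b : Bool} {s : Str} {p : Fml} (h : ReadsFml 3 b s p) :
      ReadsFml 3 b ([Sym.tilde] ++ s) (.not p)
  | and {b : Bool} {s₁ s₂ : Str} {p q : Fml} (h₁ : ReadsFml 2 false s₁ p)
      (h₂ : ReadsFml 3 b s₂ q) : ReadsFml 2 b (s₁ ++ [Sym.amp] ++ s₂) (.and p q)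
  | or {b : Bool} {s₁ s₂ : Str} {p q : Fml} (h₁ : ReadsFml 1 false s₁ p)
      (h₂ : ReadsFml 2 b s₂ q) : ReadsFml 1 b (s₁ ++ [Sym.bar] ++ s₂) (.or p q)
  | imp {b : Bool} {s₁ s₂ : Str} {p q : Fml} (h₁ : ReadsFml 0 false s₁ p)
      (h₂ : ReadsFml 1 b s₂ q) :
      ReadsFml 0 b (s₁ ++ [Sym.dash, Sym.gt] ++ s₂) (.imp p q)
  | all {b : Bool} {s : Str} {p : Fml} (x : Var) (h : ReadsFml 0 b s p) :
      ReadsFml 4 true ([Sym.capA] ++ x.str ++ [Sym.colon] ++ s) (.all x p)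
  | ex {b : Bool} {s : Str} {p : Fml} (x : Var) (h : ReadsFml 0 b s p) :
      ReadsFml 4 true ([Sym.capE] ++ x.str ++ [Sym.colon] ++ s) (.ex x p)
  | weaken {k : ℕ} {b : Bool} {s : Str} {p : Fml} (h : ReadsFml (k + 1) b s p) :
      ReadsFml k b s p

/-- The string `s` is a formula, and it is read as `p`. -/
def IsFormula (s : Str) (p : Fml) : Prop := ∃ b : Bool, ReadsFml 0 b s p

/-- The string is a sentence: a formula without free variables. -/
def IsSentence (s : Str) : Prop := ∃ p : Fml, IsFormula s p ∧ p.free = ∅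

/-- The string is a sentence that holds in the natural numbers. -/
def IsTrueSentence (s : Str) : Prop :=
  ∃ p : Fml, IsFormula s p ∧ p.free = ∅ ∧ ∀ v : Var → ℕ, p.Holds v

/-- The string is a sentence that does not hold in the natural numbers. -/
def IsFalseSentence (s : Str) : Prop :=
  ∃ p : Fml, IsFormula s p ∧ p.free = ∅ ∧ ∀ v : Var → ℕ, ¬ p.Holds v

/-! ### Turing machines -/

/-- Head movements: one cell to the left, one cell to the right, or none. -/
inductive Move : Type
  | L | R | N

/-- A tape symbol is one of the 53 characters or the blank, which is `none`. -/
abbrev TapeSym : Type := Option Sym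

/-- A Turing machine: its states are `0, …, r` with `r` positive, state `0` is final, and there is
exactly one rule for each state other than `0` and each tape symbol. -/
structure Machine : Type where
  r : ℕ
  r_pos : 0 < r
  rule : TapeSym → {q : Fin (r + 1) // q ≠ 0} → TapeSym × Fin (r + 1) × Move

/-- A state of the control unit together with the two-way infinite tape and the head position. -/
structure Machine.Config (M : Machine) : Type where
  state : Fin (M.r + 1)
  tape : Turing.Tape TapeSym

/-- Moving the head. -/
def Move.apply : Move → Turing.Tape TapeSym → Turing.Tape TapeSym
  | .L, T => T.move Turing.Dir.left
  | .R, T => T.move Turing.Dir.right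
  | .N, T => T

/-- One computation step; a configuration in state `0` does not change any more. -/
def Machine.step (M : Machine) (c : M.Config) : M.Config :=
  if h : c.state = 0 then c
  else
    let a := M.rule c.tape.head ⟨c.state, h⟩
    ⟨a.2.1, a.2.2.apply (c.tape.write a.1)⟩

/-- The initial configuration: state `1`, the input on an otherwise blank tape, and the head on the
first character of the input. -/
def Machine.init (M : Machine) (s : Str) : M.Config :=
  ⟨⟨1, Nat.succ_lt_succ M.r_pos⟩, Turing.Tape.mk₁ (s.map some)⟩

/-- The machine eventually enters state `0` when given the input `s`. -/
def Machine.Halts (M : Machine) (s : Str) : Prop :=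
  ∃ n : ℕ, (M.step^[n] (M.init s)).state = 0

/-! ### Proof systems -/

/-- A recursively enumerable proof system for natural number arithmetic: a Turing machine that does
not halt on any string that is not a sentence. -/
structure REProofSystem : Type where
  machine : Machine
  not_halts : ∀ s : Str, ¬ IsSentence s → ¬ machine.Halts s

/-- A sentence is proven if and only if the machine halts on it. -/
def REProofSystem.Proves (P : REProofSystem) (s : Str) : Prop :=
  IsSentence s ∧ P.machine.Halts s

end NatArith

namespace NatArith

/-! ### Halting of a Turing machine is recursively enumerable -/

/-! Suppose that the system proves every true sentence and no false one. Non-halting of a program on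
input 0 can be expressed in arithmetic: there is a primitive recursive map from codes `c` to
sentences that are true exactly when `c` does not halt. Running the proof system on these sentences
would make non-halting recursively enumerable, which contradicts the unsolvability of the halting
problem. Neither self-reference nor an arithmetization of proofs is needed.

Three facts carry this. Halting of a fixed Turing machine is r.e. in the input
(`Machine.rePred_halts`). Primitive recursive functions have arithmetical graphs, with Gödel's beta
function coding the course of a recursion (`ArithFun.of_primrec`); applied to the step-bounded
evaluator `evaln`, this gives `arith_not_halting`. An arithmetical predicate of `n` yields sentences
consisting of a fixed prefix, a numeral and a fixed suffix (`Arith.exists_sentence`). -/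

instance : Finite Sym := by
  rw [← Set.finite_univ_iff]
  refine ((Set.finite_range Sym.letter).union ((Set.finite_range Sym.digit).union (Set.toFinite
    {.quote, .backslash, .eq, .ne, .lpar, .rpar, .tilde, .amp, .bar, .dash, .gt, .capA, .capE,
      .colon, .plus, .star, .lt}))).subset fun s _ => ?_
  cases s <;> simp

noncomputable instance : Primcodable Sym := Primcodable.ofEquiv _ (Finite.equivFin Sym)

namespace Machine

variable (M : Machine)

/-- The rule that applies in a given state to a given tape symbol; nothing changes in state `0`. -/
def totalRule (p : Fin (M.r + 1) × TapeSym) : TapeSym × Fin (M.r + 1) × Move :=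
  if h : p.1 = 0 then (p.2, 0, .N) else M.rule p.2 ⟨p.1, h⟩

/-- Configurations given by the state and two finite lists, for the parts of the tape to the left of
the head and from the head on. -/
abbrev ListConfig : Type := Fin (M.r + 1) × List TapeSym × List TapeSym

/-- The configuration that a list configuration stands for. -/
def ListConfig.toConfig {M : Machine} (c : M.ListConfig) : M.Config := ⟨c.1, .mk₂ c.2.1 c.2.2⟩

/-- One computation step on list configurations. -/
def listStep (c : M.ListConfig) : M.ListConfig :=
  let a := M.totalRule (c.1, c.2.2.headI)
  if a.2.2 matches .L then (a.2.1, c.2.1.tail, c.2.1.headI :: a.1 :: c.2.2.tail)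
  else if a.2.2 matches .R then (a.2.1, a.1 :: c.2.1, c.2.2.tail)
  else (a.2.1, c.2.1, a.1 :: c.2.2.tail)

/-- Cells beyond the ends of the lists are blank: the default value that `headI` returns on an empty
list is `none`. -/
theorem toConfig_listStep (c : M.ListConfig) : (M.listStep c).toConfig = M.step c.toConfig := by
  obtain ⟨q, l, r⟩ := c
  have hr : (Turing.Tape.mk₂ l r).head = r.headI := rfl
  have hw (a : TapeSym) : (Turing.Tape.mk₂ l r).write a = Turing.Tape.mk₂ l (a :: r.tail) := by
    simp [Turing.Tape.mk₂, ← Turing.ListBlank.cons_mk]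
  unfold step listStep totalRule ListConfig.toConfig
  dsimp only
  rw [hr]
  split_ifs with h₁ h₂ h₃ h₄
  all_goals simp_all
  -- In state 0 the scanned symbol is written back. This may turn an empty list into a single blank,
  -- which is the same tape.
  · rw [Turing.Tape.mk₂, Turing.Tape.mk₂, ← Turing.ListBlank.cons_mk, ← Turing.ListBlank.tail_mk, ← Turing.ListBlank.head_mk,
      Turing.ListBlank.cons_head_tail]
  all_goals
    rcases hm : M.rule r.headI ⟨q, h₁⟩ with ⟨a, q', m⟩
    cases m <;> simp_all [Move.apply, Turing.Tape.mk₂, ← Turing.ListBlank.cons_mk]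

/-- The rule table has a finite domain, so everything read off it is primitive recursive. The move
enters only through two Boolean tests, so `Move` needs no encoding. -/
theorem primrec_listStep : Primrec M.listStep := by
  have hp : Primrec fun c : M.ListConfig => (c.1, c.2.2.headI) :=
    Primrec.fst.pair (Primrec.list_headI.comp (Primrec.snd.comp Primrec.snd))
  have hw := (Primrec.dom_finite fun p => (M.totalRule p).1).comp hp
  have hq := (Primrec.dom_finite fun p => (M.totalRule p).2.1).comp hp
  have hL := (Primrec.dom_finite fun p => decide ((M.totalRule p).2.2 matches .L)).comp hp
  have hR := (Primrec.dom_finite fun p => decide ((M.totalRule p).2.2 matches .R)).comp hp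
  have hl : Primrec fun c : M.ListConfig => c.2.1 := Primrec.fst.comp Primrec.snd
  have hr : Primrec fun c : M.ListConfig => c.2.2.tail :=
    Primrec.list_tail.comp (Primrec.snd.comp Primrec.snd)
  have hr' := Primrec.list_cons.comp hw hr
  refine (Primrec.cond hL (hq.pair ((Primrec.list_tail.comp hl).pair
    (Primrec.list_cons.comp (Primrec.list_headI.comp hl) hr')))
    (Primrec.cond hR (hq.pair ((Primrec.list_cons.comp hw hl).pair hr))
      (hq.pair (hl.pair hr')))).of_eq fun c => ?_
  simp [listStep, Bool.cond_eq_ite]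

theorem halts_iff (s : Str) :
    M.Halts s ↔ ∃ n : ℕ,
      (M.listStep^[n] (⟨1, Nat.succ_lt_succ M.r_pos⟩, [], s.map some)).1 = 0 := by
  have h (n : ℕ) (c : M.ListConfig) : M.step^[n] c.toConfig = (M.listStep^[n] c).toConfig :=
    (Function.Semiconj.iterate_right (f := ListConfig.toConfig) M.toConfig_listStep n c).symm
  exact exists_congr fun n => by
    rw [show M.init s = ListConfig.toConfig (⟨1, Nat.succ_lt_succ M.r_pos⟩, [], s.map some) from rfl,
      h]
    rfl

/-- Halting is the convergence of an unbounded search for a step number at which the state is 0. -/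
theorem rePred_halts {α : Type*} [Primcodable α] {f : α → Str} (hf : Primrec f) :
    REPred fun a => M.Halts (f a) := by
  have hi : Primrec fun a : α =>
      ((⟨1, Nat.succ_lt_succ M.r_pos⟩, [], (f a).map some) : M.ListConfig) :=
    (Primrec.const _).pair ((Primrec.const _).pair
      (Primrec.list_map hf (Primrec.option_some.comp Primrec.snd).to₂))
  have h : Primrec₂ fun (a : α) (n : ℕ) => decide
      ((M.listStep^[n] (⟨1, Nat.succ_lt_succ M.r_pos⟩, [], (f a).map some)).1 = 0) :=
    (Primrec.dom_finite fun q : Fin (M.r + 1) => decide (q = 0)).comp (Primrec.fst.comp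
      (Primrec.nat_iterate Primrec.snd (hi.comp Primrec.fst)
        (M.primrec_listStep.comp Primrec.snd).to₂))
  refine (Partrec.rfind h.to_comp.partrec₂).dom_re.of_eq fun a => ?_
  rw [halts_iff]
  simp [Nat.rfind_dom]

end Machine

/-! ### Arithmetical predicates -/

/-- A sequence of distinct variables. -/
def seqVar (i : ℕ) : Var := ⟨0, List.replicate i 0⟩

theorem seqVar_injective : Function.Injective seqVar := fun i j h => by
  simpa [seqVar] using congrArg (fun x => x.digits.length) h

/-- The valuations of the variables `seqVar i` for which the predicate holds are described by a
formula that can be written as a string. -/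
def Arith (P : (ℕ → ℕ) → Prop) : Prop :=
  ∃ s p, ReadsFml 4 false s p ∧ ∀ v, p.Holds v ↔ P (v ∘ seqVar)

/-- The function of the values of the variables `seqVar i` is described by a term that can be
written as a string. -/
def ArithTerm (t : (ℕ → ℕ) → ℕ) : Prop :=
  ∃ s u, ReadsTm 2 s u ∧ ∀ v, u.val v = t (v ∘ seqVar)

theorem ReadsTm.to_zero {s t} : ∀ {k}, ReadsTm k s t → ReadsTm 0 s t
  | 0, h => h
  | _ + 1, h => h.weaken.to_zero

theorem ReadsFml.of_le {b s p} {j k : ℕ} (hjk : j ≤ k) (h : ReadsFml k b s p) :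
    ReadsFml j b s p := by
  induction k, hjk using Nat.le_induction with
  | base => exact h
  | succ k _ ih => exact ih h.weaken

namespace ArithTerm

theorem var (i : ℕ) : ArithTerm fun v => v i := ⟨_, _, .var (seqVar i), fun _ => rfl⟩

theorem zero : ArithTerm fun _ => 0 := ⟨_, _, .lit [0] (.inl rfl), fun _ => rfl⟩

theorem one : ArithTerm fun _ => 1 := ⟨_, _, .lit [1] (.inr (by decide)), fun _ => rfl⟩

theorem add {t u} (ht : ArithTerm t) (hu : ArithTerm u) : ArithTerm fun v => t v + u v := by
  obtain ⟨s, t', h, ht⟩ := ht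
  obtain ⟨s', u', h', hu⟩ := hu
  exact ⟨_, _, .paren (.add h.to_zero h'.weaken), fun v => by simp [Tm.val, ht, hu]⟩

theorem mul {t u} (ht : ArithTerm t) (hu : ArithTerm u) : ArithTerm fun v => t v * u v := by
  obtain ⟨s, t', h, ht⟩ := ht
  obtain ⟨s', u', h', hu⟩ := hu
  exact ⟨_, _, .paren (.weaken (.mul h.weaken h')), fun v => by simp [Tm.val, ht, hu]⟩

end ArithTerm

namespace Arith

variable {P Q : (ℕ → ℕ) → Prop}

theorem eq {t u} (ht : ArithTerm t) (hu : ArithTerm u) : Arith fun v => t v = u v := by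
  obtain ⟨s, t', h, ht⟩ := ht
  obtain ⟨s', u', h', hu⟩ := hu
  exact ⟨_, _, .eq h.to_zero h'.to_zero, fun v => by simp [Fml.Holds, ht, hu]⟩

/-- Enclosing a compound formula in parentheses restores level 4 and flag `false`, so that it can be
an operand of any connective. -/
theorem not (hP : Arith P) : Arith fun v => ¬ P v := by
  obtain ⟨s, p, h, hp⟩ := hP
  exact ⟨_, _, .paren (.of_le (Nat.zero_le 3) (.not h.weaken)), fun v => by simp [Fml.Holds, hp]⟩

theorem and (hP : Arith P) (hQ : Arith Q) : Arith fun v => P v ∧ Q v := by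
  obtain ⟨s, p, h, hp⟩ := hP
  obtain ⟨s', q, h', hq⟩ := hQ
  exact ⟨_, _, .paren (.of_le (Nat.zero_le 2) (.and (h.of_le (by decide)) h'.weaken)),
    fun v => by simp [Fml.Holds, hp, hq]⟩

theorem of_iff (hP : Arith P) (h : ∀ v, P v ↔ Q v) : Arith Q := by
  rwa [← show P = Q from funext fun v => propext (h v)]

theorem or (hP : Arith P) (hQ : Arith Q) : Arith fun v => P v ∨ Q v :=
  (hP.not.and hQ.not).not.of_iff fun _ => by tauto

theorem imp (hP : Arith P) (hQ : Arith Q) : Arith fun v => P v → Q v :=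
  (hP.not.or hQ).of_iff fun _ => by tauto

theorem ex_update (k : ℕ) (hP : Arith P) : Arith fun v => ∃ a, P (Function.update v k a) := by
  obtain ⟨s, p, h, hp⟩ := hP
  refine ⟨_, _, .paren (.of_le (Nat.zero_le 4) (.ex (seqVar k) (h.of_le (Nat.zero_le 4)))),
    fun v => ?_⟩
  simp [Fml.Holds, hp, Function.update_comp_eq_of_injective v seqVar_injective]

/-- An existential quantifier, where the `k`-th variable is used for the bound variable. -/
theorem ex {R : (ℕ → ℕ) → ℕ → Prop} (k : ℕ) (hR : Arith fun v => R v (v k))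
    (hk : ∀ v a b, R (Function.update v k b) a ↔ R v a) : Arith fun v => ∃ a, R v a :=
  (hR.ex_update k).of_iff fun v => by simp [hk]

/-- A universal quantifier, where the `k`-th variable is used for the bound variable. -/
theorem all {R : (ℕ → ℕ) → ℕ → Prop} (k : ℕ) (hR : Arith fun v => R v (v k))
    (hk : ∀ v a b, R (Function.update v k b) a ↔ R v a) : Arith fun v => ∀ a, R v a :=
  (ex (R := fun v a => ¬ R v a) k hR.not fun v a b => not_congr (hk v a b)).not.of_iff fun v => by simp

theorem lt (i j : ℕ) : Arith fun v => v i < v j := by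
  refine (ex (R := fun v d => v i + (d + 1) = v j) (i + j + 1)
    (eq ((ArithTerm.var i).add ((ArithTerm.var _).add .one)) (.var j)) fun v a b => ?_).of_iff
    fun v => ?_
  · rw [Function.update_of_ne (by omega), Function.update_of_ne (by omega)]
  · exact ⟨fun ⟨d, hd⟩ => by omega, fun h => ⟨v j - v i - 1, by omega⟩⟩

theorem pair (i j k : ℕ) : Arith fun v => v k = Nat.pair (v i) (v j) := by
  refine (((lt i j).and (eq (.var k) (((ArithTerm.var j).mul (.var j)).add (.var i)))).or
    ((lt i j).not.and (eq (.var k)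
      ((((ArithTerm.var i).mul (.var i)).add (.var i)).add (.var j))))).of_iff fun v => ?_
  unfold Nat.pair
  split_ifs with h <;> simp [h]

/-- `Nat.beta` is the remainder of one component of the pair `c` modulo `m`; a remainder is
characterized by a quotient `q` and the bound `y < m`. -/
theorem beta (c i y : ℕ) : Arith fun v => v y = Nat.beta (v c) (v i) := by
  have H : Arith fun v => ∃ a b q m, v c = Nat.pair a b ∧ m = (v i + 1) * b + 1 ∧ v y < m ∧
      a = q * m + v y := by
    -- Indices beyond the sum of the free ones are fresh; the side goals say that the bound
    -- variables do not interfere.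
    refine ex (c + i + y + 1) (ex (c + i + y + 2) (ex (c + i + y + 3) (ex (c + i + y + 4)
      ((pair _ _ _).and ((eq (.var _) ((((ArithTerm.var _).add .one).mul (.var _)).add .one)).and
        ((lt _ _).and (eq (.var _) (((ArithTerm.var _).mul (.var _)).add (.var _))))))
      ?_) ?_) ?_) ?_
    all_goals
      intro v _ _
      simp (disch := omega) only [Function.update_of_ne]
  refine H.of_iff fun v => ⟨?_, fun h => ?_⟩
  · rintro ⟨a, b, q, m, hc, rfl, hlt, rfl⟩
    rw [Nat.beta, hc, Nat.unpair_pair, Nat.mul_add_mod', Nat.mod_eq_of_lt hlt]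
  · refine ⟨(v c).unpair.1, (v c).unpair.2, (v c).unpair.1 / ((v i + 1) * (v c).unpair.2 + 1), _,
      by simp, rfl, ?_, ?_⟩
    · rw [h]; exact Nat.mod_lt _ (Nat.succ_pos _)
    · rw [h]; exact (Nat.div_add_mod' _ _).symm

end Arith

/-! ### Primitive recursive functions have arithmetical graphs -/

/-- The graph of the function is arithmetical, with respect to any two variables. -/
def ArithFun (f : ℕ → ℕ) : Prop := ∀ i j, Arith fun v => v j = f (v i)

theorem exists_beta (f : ℕ → ℕ) (n : ℕ) : ∃ c, ∀ m ≤ n, Nat.beta c m = f m := by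
  refine ⟨Nat.unbeta ((List.range (n + 1)).map f), fun m hm => ?_⟩
  simpa using Nat.beta_unbeta_coe ((List.range (n + 1)).map f) ⟨m, by simpa using by omega⟩

/-- The number `c` codes the whole history of the recursion up to `n`, which turns a recursive
definition into a first-order one. -/
theorem eq_rec_iff_beta {z : ℕ} {g : ℕ → ℕ → ℕ} {n y : ℕ} :
    y = n.rec (motive := fun _ => ℕ) z g ↔
      ∃ c, Nat.beta c 0 = z ∧ y = Nat.beta c n ∧
        ∀ m, m < n → Nat.beta c (m + 1) = g m (Nat.beta c m) := by
  constructor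
  · rintro rfl
    obtain ⟨c, hc⟩ := exists_beta (fun n => n.rec (motive := fun _ => ℕ) z g) n
    exact ⟨c, hc 0 n.zero_le, (hc n le_rfl).symm, fun m hm => by
      rw [hc (m + 1) hm, hc m hm.le]⟩
  · rintro ⟨c, h0, rfl, hs⟩
    have h (m : ℕ) (hm : m ≤ n) : Nat.beta c m = m.rec (motive := fun _ => ℕ) z g := by
      induction m with
      | zero => exact h0
      | succ m ih => rw [hs m hm, ih (by omega)]
    exact h n le_rfl

namespace ArithFun

open Arith

theorem unpair_fst : ArithFun fun n => n.unpair.1 := fun i j => by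
  refine (ex (R := fun v b => v i = Nat.pair (v j) b) (i + j + 1) (Arith.pair _ _ _) ?_).of_iff
    fun v => ⟨?_, fun h => ⟨(v i).unpair.2, by simp [h]⟩⟩
  · intro v _ _
    simp (disch := omega) only [Function.update_of_ne]
  · rintro ⟨b, h⟩
    simp [h]

theorem unpair_snd : ArithFun fun n => n.unpair.2 := fun i j => by
  refine (ex (R := fun v a => v i = Nat.pair a (v j)) (i + j + 1) (Arith.pair _ _ _) ?_).of_iff
    fun v => ⟨?_, fun h => ⟨(v i).unpair.1, by simp [h]⟩⟩
  · intro v _ _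
    simp (disch := omega) only [Function.update_of_ne]
  · rintro ⟨b, h⟩
    simp [h]

variable {f g : ℕ → ℕ}

theorem pair (hf : ArithFun f) (hg : ArithFun g) : ArithFun fun n => Nat.pair (f n) (g n) :=
  fun i j => by
  refine (ex (R := fun v a => ∃ b, a = f (v i) ∧ b = g (v i) ∧ v j = Nat.pair a b) (i + j + 1)
    (ex (i + j + 2) ((hf _ _).and ((hg _ _).and (Arith.pair _ _ _))) ?_) ?_).of_iff fun v => ?_
  iterate 2
    intro v _ _
    simp (disch := omega) only [Function.update_of_ne]
  simp

/-- The intermediate value is stored in a fresh variable. Since `ArithFun` covers all pairs of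
variables, no substitution in formulas is needed. -/
theorem comp (hf : ArithFun f) (hg : ArithFun g) : ArithFun fun n => f (g n) := fun i j => by
  refine (ex (R := fun v a => a = g (v i) ∧ v j = f a) (i + j + 1)
    ((hg _ _).and (hf _ _)) ?_).of_iff fun v => ?_
  · intro v _ _
    simp (disch := omega) only [Function.update_of_ne]
  · simp

theorem prec (hf : ArithFun f) (hg : ArithFun g) :
    ArithFun (Nat.unpaired fun z n =>
      n.rec (f z) fun y IH => g (Nat.pair z (Nat.pair y IH))) := fun i j => by
  -- Every intermediate value, even the index 0, gets its own variable, because the available graph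
  -- formulas relate variables only.
  have H : Arith fun v => ∃ a n c z w, v i = Nat.pair a n ∧ z = 0 ∧ w = f a ∧ w = Nat.beta c z ∧
      v j = Nat.beta c n ∧ ∀ m, m < n → ∃ m' x y p q, m' = m + 1 ∧ x = Nat.beta c m ∧
        y = Nat.beta c m' ∧ p = Nat.pair m x ∧ q = Nat.pair a p ∧ y = g q := by
    refine ex (i + j + 1) (ex (i + j + 2) (ex (i + j + 3) (ex (i + j + 4) (ex (i + j + 5)
      ((Arith.pair _ _ _).and ((eq (.var _) .zero).and ((hf _ _).and ((beta _ _ _).and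
        ((beta _ _ _).and (all (i + j + 6) ((lt _ _).imp
          (ex (i + j + 7) (ex (i + j + 8) (ex (i + j + 9) (ex (i + j + 10) (ex (i + j + 11)
            ((eq (.var _) ((ArithTerm.var _).add .one)).and ((beta _ _ _).and ((beta _ _ _).and
              ((Arith.pair _ _ _).and ((Arith.pair _ _ _).and (hg _ _))))))
            ?_) ?_) ?_) ?_) ?_)) ?_)))))) ?_) ?_) ?_) ?_) ?_
    all_goals
      intro v _ _
      simp (disch := omega) only [Function.update_of_ne]
  refine H.of_iff fun v => ?_
  rw [Nat.unpaired, eq_rec_iff_beta]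
  constructor
  · rintro ⟨a, n, c, z, w, hi, rfl, rfl, h0, hj, hs⟩
    rw [hi, Nat.unpair_pair]
    refine ⟨c, h0.symm, hj, fun m hm => ?_⟩
    obtain ⟨m', x, y, p, q, rfl, rfl, rfl, rfl, rfl, h⟩ := hs m hm
    exact h
  · rintro ⟨c, h0, hj, hs⟩
    exact ⟨_, _, c, _, _, (Nat.pair_unpair _).symm, rfl, rfl, h0.symm, hj, fun m hm =>
      ⟨_, _, _, _, _, rfl, rfl, rfl, rfl, rfl, hs m hm⟩⟩

theorem of_primrec (h : Nat.Primrec f) : ArithFun f := by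
  induction h with
  | zero => exact fun i j => eq (.var j) .zero
  | succ => exact fun i j => eq (.var j) ((ArithTerm.var i).add .one)
  | left => exact unpair_fst
  | right => exact unpair_snd
  | pair _ _ hf hg => exact hf.pair hg
  | comp _ _ hf hg => exact hf.comp hg
  | prec _ _ hf hg => exact hf.prec hg

end ArithFun

/-! ### Sentences for arithmetical predicates -/

/-- The string `0+1+…+1` that denotes a natural number. -/
def numeral (n : ℕ) : Str :=
  n.rec (motive := fun _ => Str) [.digit 0] fun _ s => s ++ [.plus, .digit 1]

theorem readsTm_numeral (n : ℕ) : ∃ t : Tm, ReadsTm 0 (numeral n) t ∧ t.vars = ∅ ∧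
    ∀ v, t.val v = n := by
  induction n with
  | zero => exact ⟨_, (ReadsTm.lit [0] (.inl rfl)).to_zero, rfl, fun _ => rfl⟩
  | succ n ih =>
    obtain ⟨t, h, ht, hv⟩ := ih
    have h' := ReadsTm.add h (ReadsTm.lit [1] (.inr (by decide))).weaken
    refine ⟨_, by simpa [numeral] using h', by simp [Tm.vars, ht], fun v => ?_⟩
    simp [Tm.val, hv, decimalValue]

theorem primrec_numeral : Primrec numeral :=
  Primrec.nat_rec₁ _ (Primrec.list_append.comp Primrec.snd (Primrec.const _)).to₂

theorem Tm.finite_vars (t : Tm) : t.vars.Finite := by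
  induction t with
  | var x => exact Set.finite_singleton x
  | num n => exact Set.finite_empty
  | add t u ht hu => exact ht.union hu
  | mul t u ht hu => exact ht.union hu

theorem Fml.finite_free (p : Fml) : p.free.Finite := by
  induction p with
  | eq t u => exact t.finite_vars.union u.finite_vars
  | ne t u => exact t.finite_vars.union u.finite_vars
  | not p hp => exact hp
  | and p q hp hq => exact hp.union hq
  | or p q hp hq => exact hp.union hq
  | imp p q hp hq => exact hp.union hq
  | all x p hp => exact hp.sdiff
  | ex x p hp => exact hp.sdiff

/-- Universal quantification over the variables of a list. -/
def Fml.allList (l : List Var) (p : Fml) : Fml := l.foldr Fml.all p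

theorem Fml.free_allList (l : List Var) (p : Fml) :
    (Fml.allList l p).free = p.free \ {x | x ∈ l} := by
  induction l with
  | nil => simp [allList]
  | cons x l ih =>
    rw [show allList (x :: l) p = .all x (allList l p) from rfl, Fml.free, ih]
    ext y
    simp
    tauto

theorem Fml.holds_allList (l : List Var) {p : Fml} {c : Prop} (h : ∀ v, p.Holds v ↔ c) :
    ∀ v, (Fml.allList l p).Holds v ↔ c := by
  induction l with
  | nil => exact h
  | cons x l ih => exact fun v => (forall_congr' fun n => ih _).trans (forall_const ℕ)

theorem isFormula_allList (l : List Var) {s : Str} {p : Fml} (h : IsFormula s p) :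
    IsFormula ((l.flatMap fun x => [Sym.capA] ++ x.str ++ [Sym.colon]) ++ s)
      (Fml.allList l p) := by
  induction l with
  | nil => exact h
  | cons x l ih =>
    obtain ⟨b, hb⟩ := ih
    exact ⟨true, by simpa [Fml.allList] using (ReadsFml.all x hb).of_le (Nat.zero_le 4)⟩

/-- `Arith` does not restrict which variables occur free in `p`, so all of them are quantified
universally. This is harmless because the truth value of the quantified formula does not depend on
the valuation. The number enters through `Ex:x=n&p`, which replaces substitution into `p` and leaves
the prefix and suffix independent of `n`. -/
theorem Arith.exists_sentence {P : ℕ → Prop} (h : Arith fun v => P (v 0)) :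
    ∃ s₁ s₂ : Str, ∀ n, ∃ p, IsFormula (s₁ ++ numeral n ++ s₂) p ∧ p.free = ∅ ∧
      ∀ v, p.Holds v ↔ P n := by
  obtain ⟨s, p, hs, hp⟩ := h
  let x := seqVar 0
  let l := p.finite_free.toFinset.toList
  refine ⟨(l.flatMap fun x => [Sym.capA] ++ x.str ++ [Sym.colon]) ++
    ([Sym.capE] ++ x.str ++ [Sym.colon] ++ x.str ++ [Sym.eq]), [Sym.amp] ++ s, fun n => ?_⟩
  obtain ⟨t, ht, hf, hv⟩ := readsTm_numeral n
  refine ⟨Fml.allList l (.ex x (.and (.eq (.var x) t) p)), ?_, ?_,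
    Fml.holds_allList l fun v => ?_⟩
  · have h₁ := (ReadsFml.eq (ReadsTm.var x).to_zero ht).of_le (show 2 ≤ 4 by decide)
    have h₂ := (ReadsFml.ex x ((ReadsFml.and h₁ hs.weaken).of_le (Nat.zero_le 2))).of_le
      (Nat.zero_le 4)
    simpa using isFormula_allList l ⟨true, h₂⟩
  · rw [Fml.free_allList]
    ext y
    simp [l, Fml.free, Tm.vars, hf]
  · simp [Fml.Holds, Tm.val, hv, hp, x]

/-! ### Non-halting as an arithmetical predicate -/

/-- A program halts if and only if `evaln` returns a value for some bound `k`, and `evaln` is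
primitive recursive. -/
theorem arith_not_halting : Arith fun v =>
    ¬ (Nat.Partrec.Code.eval (Denumerable.ofNat Nat.Partrec.Code (v 0)) 0).Dom := by
  have hg : Primrec fun m : ℕ => (Nat.Partrec.Code.evaln m.unpair.1
      (Denumerable.ofNat Nat.Partrec.Code m.unpair.2) 0).isSome.toNat :=
    (Primrec.dom_bool Bool.toNat).comp (Primrec.option_isSome.comp
      (Nat.Partrec.Code.primrec_evaln.comp (((Primrec.fst.comp Primrec.unpair).pair
        ((Primrec.ofNat _).comp (Primrec.snd.comp Primrec.unpair))).pair (Primrec.const 0))))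
  have hf := ArithFun.of_primrec (Primrec.nat_iff.1 hg)
  refine (Arith.not (Arith.ex (R := fun v k => ∃ m b, m = Nat.pair k (v 0) ∧ b = 1 ∧
    b = (Nat.Partrec.Code.evaln m.unpair.1
      (Denumerable.ofNat Nat.Partrec.Code m.unpair.2) 0).isSome.toNat) 1 (Arith.ex 2 (Arith.ex 3
        ((Arith.pair _ _ _).and ((Arith.eq (.var _) .one).and (hf _ _))) ?_) ?_) ?_)).of_iff
      fun v => not_congr ?_
  iterate 3
    intro v _ _
    simp (disch := omega) only [Function.update_of_ne]
  simp only [exists_and_left, exists_eq_left, Nat.unpair_pair, Part.dom_iff_mem,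
    Nat.Partrec.Code.evaln_complete, Option.mem_def]
  rw [exists_comm]
  refine exists_congr fun k => ?_
  rw [← Option.isSome_iff_exists, eq_comm, Bool.toNat_eq_one]

end NatArith

theorem theorem2 (P : NatArith.REProofSystem) :
    (∃ s : NatArith.Str, NatArith.IsFalseSentence s ∧ P.Proves s) ∨
      (∃ s : NatArith.Str, NatArith.IsTrueSentence s ∧ ¬ P.Proves s) := by
  by_contra! hP
  obtain ⟨hfalse, htrue⟩ := hP
  obtain ⟨s₁, s₂, hs⟩ := NatArith.arith_not_halting.exists_sentence
    (P := fun n => ¬ (Nat.Partrec.Code.eval (Denumerable.ofNat Nat.Partrec.Code n) 0).Dom)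
  have hσ : Primrec fun c : Nat.Partrec.Code => s₁ ++ NatArith.numeral (Encodable.encode c) ++ s₂ :=
    Primrec.list_append.comp (Primrec.list_append.comp (Primrec.const _)
      (NatArith.primrec_numeral.comp Primrec.encode)) (Primrec.const _)
  -- It remains to show that the machine halts on the sentence for `c` exactly when `c` does not
  -- halt on 0: one direction uses that no false sentence is proved, the other that every true one
  -- is.
  refine ComputablePred.halting_problem_not_re 0
    ((P.machine.rePred_halts hσ).of_eq fun c => ?_)
  obtain ⟨p, hp, hfree, hv⟩ := hs (Encodable.encode c)
  rw [Denumerable.ofNat_encode] at hv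
  constructor
  · intro h hc
    exact hfalse _ ⟨p, hp, hfree, fun v => by simpa [hv] using hc⟩ ⟨⟨p, hp, hfree⟩, h⟩
  · intro hc
    exact (htrue _ ⟨p, hp, hfree, fun v => (hv v).2 hc⟩).2
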